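/- Let $\Lambda$ be a finite-dimensional algebra over a field $k$, let $\Lambda\text{-mod}$ be the category of finitely generated $\Lambda$-modules, and let $D^b(\Lambda)$ be its bounded derived category. An object of $D^b(\Lambda)$ is called a module if it is isomorphic to a complex concentrated in degree $0$ (equivalently, its only non-zero homology is in degree $0$). An Auslander-Reiten (AR) triangle is a distinguished triangle $L\to M\to N\xrightarrow{h} L[1]$ with $L,N$ indecomposable and $h\ne 0$ such that every morphism $W\to N$ that is not a split epimorphism factors through $M\to N$. An AR sequence is a non-split short exact sequence $0\to L\to M\to N\to 0$ of modules with $L,N$ indecomposable such that every map $W\to N$ that is not a split epimorphism factors through $M\to N$ and every map $L\to W$ that is not a split monomorphism factors through $L\to M$. The AR quiver of either category has as vertices the isomorphism classes of indecomposable objects; there is an arrow $X\to Y$ when $\operatorname{Irr}(X,Y)=\operatorname{rad}(X,Y)/\operatorname{rad}^2(X,Y)\neq 0$, and it carries the valuation $(a,b)$, where $a$ and $b$ are the lengths of $\operatorname{Irr}(X,Y)$ over $\operatorname{End}(X)$ and $\operatorname{End}(Y)$; and $\tau N=L$ when $L$ and $N$ are the left and right ends of an AR triangle (respectively, AR sequence).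 The mesh ending at a vertex $N$ for which $\tau N$ is defined consists of the vertices $\tau N$, $N$ and all direct predecessors $Y$ of $N$, the arrows $\tau N\to Y\to N$ for these $Y$, and the translation $N\mapsto\tau N$. 1. If $L\to M\to N\to L[1]$ is an AR triangle in $D^b(\Lambda)$ such that $L$, $M$ and $N$ are all modules, then $0\to H_0(L)\to H_0(M)\to H_0(N)\to 0$ is an AR sequence of $\Lambda$-modules. 2. If $\Theta$ is a union of meshes of the AR quiver of $D^b(\Lambda)$ all of whose vertices are modules, then $\Theta$ is copied into the AR quiver of $\Lambda\text{-mod}$: there is a union of meshes $\Theta'$ of the AR quiver of $\Lambda\text{-mod}$ such that $X\mapsto H_0(X)$ gives a bijection from the vertices of $\Theta$ to those of $\Theta'$ under which the arrows of $\Theta$ correspond to the arrows of $\Theta'$ with the same valuations, and the translation on $\Theta$ corresponds to the translation on $\Theta'$. -/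

import Mathlib

open CategoryTheory CategoryTheory.Limits CategoryTheory.Pretriangulated

universe w v u

noncomputable section

namespace AuslanderReiten

/-! ### The radical of a preadditive category and the bimodule of irreducible maps -/

section Radical

variable {C : Type u} [Category.{v} C] [Preadditive C]

/-- `f : X ⟶ Y` lies in the (Jacobson) radical of the category: `1 - f ≫ g` is invertible for
every `g : Y ⟶ X`. Between objects with local endomorphism rings this means that `f` is not an
isomorphism. -/
def InRadical {X Y : C} (f : X ⟶ Y) : Prop :=
  ∀ g : Y ⟶ X, IsIso (𝟙 X - f ≫ g)

lemma isIso_one_sub_swap {X Y : C} (f : X ⟶ Y) (g : Y ⟶ X) [IsIso (𝟙 X - f ≫ g)] :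
    IsIso (𝟙 Y - g ≫ f) := by
  have h₁ := IsIso.hom_inv_id (𝟙 X - f ≫ g)
  have h₂ := IsIso.inv_hom_id (𝟙 X - f ≫ g)
  generalize inv (𝟙 X - f ≫ g) = u at h₁ h₂
  rw [Preadditive.sub_comp, Category.id_comp, Category.assoc] at h₁
  rw [Preadditive.comp_sub, Category.comp_id] at h₂
  have h₁' : f ≫ g ≫ u = u - 𝟙 X := by rw [← h₁]; abel
  have h₂' : u ≫ f ≫ g = u - 𝟙 X := by rw [← h₂]; abel
  refine ⟨𝟙 Y + g ≫ u ≫ f, ?_, ?_⟩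
  · have h : g ≫ f ≫ g ≫ u ≫ f = g ≫ u ≫ f - g ≫ f := by
      have := congrArg (fun t => g ≫ t ≫ f) h₁'
      simpa [Preadditive.sub_comp, Preadditive.comp_sub] using this
    simp only [Preadditive.sub_comp, Preadditive.comp_add, Category.comp_id, Category.id_comp,
      Category.assoc, h]
    abel
  · have h : g ≫ u ≫ f ≫ g ≫ f = g ≫ u ≫ f - g ≫ f := by
      have := congrArg (fun t => g ≫ t ≫ f) h₂'
      simpa [Preadditive.sub_comp, Preadditive.comp_sub] using this
    simp only [Preadditive.add_comp, Preadditive.comp_sub, Category.comp_id, Category.id_comp,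
      Category.assoc, h]
    abel

lemma inRadical_zero (X Y : C) : InRadical (0 : X ⟶ Y) := fun g => by
  rw [zero_comp, sub_zero]; infer_instance

lemma InRadical.comp {X Y Z : C} {f : X ⟶ Y} (hf : InRadical f) (r : Y ⟶ Z) :
    InRadical (f ≫ r) := fun g => by
  rw [Category.assoc]; exact hf _

lemma InRadical.precomp {X Y Z : C} {f : X ⟶ Y} (hf : InRadical f) (r : Z ⟶ X) :
    InRadical (r ≫ f) := fun g => by
  have : IsIso (𝟙 X - (f ≫ g) ≫ r) := by rw [Category.assoc]; exact hf _
  rw [Category.assoc]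
  exact isIso_one_sub_swap (f ≫ g) r

lemma InRadical.add {X Y : C} {f f' : X ⟶ Y} (hf : InRadical f) (hf' : InRadical f') :
    InRadical (f + f') := fun g => by
  have := hf g
  have := hf' (g ≫ inv (𝟙 X - f ≫ g))
  have h : 𝟙 X - (f + f') ≫ g =
      (𝟙 X - f' ≫ g ≫ inv (𝟙 X - f ≫ g)) ≫ (𝟙 X - f ≫ g) := by
    rw [Preadditive.sub_comp, Category.assoc, Category.assoc, IsIso.inv_hom_id, Category.comp_id,
      Category.id_comp, Preadditive.add_comp]
    abel
  rw [h]
  infer_instance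

/-- `rad(X, Y)` as a module over `End Y`. -/
def radTarget (X Y : C) : Submodule (End Y) (X ⟶ Y) where
  carrier := {f | InRadical f}
  add_mem' := InRadical.add
  zero_mem' := inRadical_zero X Y
  smul_mem' r _ hf := InRadical.comp hf r

/-- `rad(X, Y)` as a module over `(End X)ᵐᵒᵖ`. -/
def radSource (X Y : C) : Submodule (End X)ᵐᵒᵖ (X ⟶ Y) where
  carrier := {f | InRadical f}
  add_mem' := InRadical.add
  zero_mem' := inRadical_zero X Y
  smul_mem' r _ hf := InRadical.precomp hf r.unop

/-- The composites of two radical morphisms; their sums form `rad²(X, Y)`. -/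
def radicalComposites (X Y : C) : Set (X ⟶ Y) :=
  {h | ∃ (Z : C) (f : X ⟶ Z) (g : Z ⟶ Y), InRadical f ∧ InRadical g ∧ f ≫ g = h}

/-- `Irr(X, Y) = rad(X, Y) / rad²(X, Y)` as a module over `End Y`. -/
abbrev IrrTarget (X Y : C) :=
  radTarget X Y ⧸ (Submodule.span (End Y) (radicalComposites X Y)).submoduleOf (radTarget X Y)

/-- `Irr(X, Y) = rad(X, Y) / rad²(X, Y)` as a module over `(End X)ᵐᵒᵖ`. -/
abbrev IrrSource (X Y : C) :=
  radSource X Y ⧸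
    (Submodule.span (End X)ᵐᵒᵖ (radicalComposites X Y)).submoduleOf (radSource X Y)

/-- The valuation `(a, b)` of the Auslander-Reiten quiver at `(X, Y)`. For objects with local
endomorphism rings, `Irr(X, Y)` is killed by the radicals of `End X` and `End Y`, so `a` and `b`
are its dimensions over the division rings `End X / rad` and `End Y / rad`. -/
def irrValuation (X Y : C) : ℕ∞ × ℕ∞ :=
  (Module.length (End X)ᵐᵒᵖ (IrrSource X Y), Module.length (End Y) (IrrTarget X Y))

end Radical

/-! ### Valued translation quivers, meshes and unions of meshes -/

/-- The data of a valued quiver with a partially defined translation: there is an arrow `x ⟶ y`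
if and only if `valuation x y ≠ 0`, and `IsTranslate x z` means that `τ z` is defined and equal
to `x`. -/
structure ValuedTranslationQuiver where
  Vertex : Type u
  valuation : Vertex → Vertex → ℕ∞ × ℕ∞
  IsTranslate : Vertex → Vertex → Prop

namespace ValuedTranslationQuiver

/-- There is an arrow from `x` to `y`. -/
def Arrow (Q : ValuedTranslationQuiver.{u}) (x y : Q.Vertex) : Prop :=
  Q.valuation x y ≠ 0

/-- A part of a valued translation quiver: some vertices, some of the arrows between them, and
some of the pairs `(τ z, z)`. -/
@[ext]
structure Part (Q : ValuedTranslationQuiver.{u}) where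
  vertices : Set Q.Vertex
  arrows : Set (Q.Vertex × Q.Vertex)
  translates : Set (Q.Vertex × Q.Vertex)

/-- The mesh with right end `z` and left end `x = τ z`: its middle vertices are the direct
predecessors `y` of `z`, and its arrows are the arrows `x ⟶ y` and `y ⟶ z`. -/
def mesh (Q : ValuedTranslationQuiver.{u}) (x z : Q.Vertex) : Q.Part where
  vertices := {x, z} ∪ {y | Q.Arrow y z}
  arrows := {p | ∃ y, Q.Arrow y z ∧ Q.Arrow p.1 p.2 ∧ (p = (x, y) ∨ p = (y, z))}
  translates := {(x, z)}

/-- `Θ` is the union of the meshes with right end in some set `S` of vertices `z` for which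
`τ z` is defined. -/
def Part.IsUnionOfMeshes {Q : ValuedTranslationQuiver.{u}} (Θ : Q.Part) : Prop :=
  ∃ S : Set (Q.Vertex × Q.Vertex), (∀ p ∈ S, Q.IsTranslate p.1 p.2) ∧
    Θ.vertices = ⋃ p ∈ S, (Q.mesh p.1 p.2).vertices ∧
    Θ.arrows = ⋃ p ∈ S, (Q.mesh p.1 p.2).arrows ∧
    Θ.translates = ⋃ p ∈ S, (Q.mesh p.1 p.2).translates

/-- An isomorphism between parts of two valued translation quivers: a bijection on vertices
which respects arrows, their valuations and the translation. -/
structure Part.Iso {Q : ValuedTranslationQuiver.{u}} {Q' : ValuedTranslationQuiver.{v}}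
    (Θ : Q.Part) (Θ' : Q'.Part) where
  toEquiv : Θ.vertices ≃ Θ'.vertices
  arrows_iff : ∀ x y : Θ.vertices,
    ((x : Q.Vertex), (y : Q.Vertex)) ∈ Θ.arrows ↔
      ((toEquiv x : Q'.Vertex), (toEquiv y : Q'.Vertex)) ∈ Θ'.arrows
  valuation_eq : ∀ x y : Θ.vertices, ((x : Q.Vertex), (y : Q.Vertex)) ∈ Θ.arrows →
    Q'.valuation (toEquiv x) (toEquiv y) = Q.valuation x y
  translates_iff : ∀ x z : Θ.vertices,
    ((x : Q.Vertex), (z : Q.Vertex)) ∈ Θ.translates ↔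
      ((toEquiv x : Q'.Vertex), (toEquiv z : Q'.Vertex)) ∈ Θ'.translates

end ValuedTranslationQuiver

/-! ### Isomorphism classes of indecomposable objects -/

section Indecomposables

variable (C : Type u) [Category.{v} C] [HasZeroMorphisms C] [HasBinaryBiproducts C]

/-- Two indecomposable objects are identified when they are isomorphic. -/
def indecSetoid : Setoid {X : C // Indecomposable X} :=
  (isIsomorphicSetoid C).comap Subtype.val

/-- The isomorphism classes of indecomposable objects. -/
def IndecClass : Type u := Quotient (indecSetoid C)

variable {C}

/-- The isomorphism class of an indecomposable object. -/
def IndecClass.mk (X : C) (hX : Indecomposable X) : IndecClass C :=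
  Quotient.mk (indecSetoid C) ⟨X, hX⟩

/-- A chosen indecomposable object in the isomorphism class. -/
def IndecClass.rep (x : IndecClass C) : C :=
  (Quotient.out (s := indecSetoid C) x).1

end Indecomposables

/-! ### Auslander-Reiten sequences and the Auslander-Reiten quiver of an abelian category -/

section Sequences

variable {C : Type u} [Category.{v} C] [Abelian C]

/-- `0 ⟶ L ⟶ M ⟶ N ⟶ 0` is an Auslander-Reiten (almost split) sequence: it is exact, has
indecomposable ends, `M ⟶ N` is right almost split and `L ⟶ M` is left almost split. -/
structure IsARSequence (S : ShortComplex C) : Prop where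
  shortExact : S.ShortExact
  indecomposable_left : Indecomposable S.X₁
  indecomposable_right : Indecomposable S.X₃
  not_splitMono : ¬ IsSplitMono S.f
  not_splitEpi : ¬ IsSplitEpi S.g
  lift : ∀ (W : C) (t : W ⟶ S.X₃), ¬ IsSplitEpi t → ∃ s : W ⟶ S.X₂, s ≫ S.g = t
  extend : ∀ (W : C) (t : S.X₁ ⟶ W), ¬ IsSplitMono t → ∃ s : S.X₂ ⟶ W, S.f ≫ s = t

variable (C)

/-- The Auslander-Reiten quiver of an abelian category: vertices are isomorphism classes of
indecomposable objects, arrows are valued by the bimodules `Irr(X, Y)`, and `τ` sends the right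
end of an Auslander-Reiten sequence to its left end. -/
def abelianARQuiver : ValuedTranslationQuiver.{u} where
  Vertex := IndecClass C
  valuation x y := irrValuation x.rep y.rep
  IsTranslate x z := ∃ S : ShortComplex C, IsARSequence S ∧
    Nonempty (S.X₁ ≅ x.rep) ∧ Nonempty (S.X₃ ≅ z.rep)

end Sequences

/-! ### Auslander-Reiten triangles and the Auslander-Reiten quiver of a triangulated category -/

section Triangles

variable {C : Type u} [Category.{v} C] [Preadditive C] [HasZeroObject C] [HasShift C ℤ]
  [∀ n : ℤ, (shiftFunctor C n).Additive] [Pretriangulated C]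

/-- `L ⟶ M ⟶ N ⟶ L[1]` is an Auslander-Reiten triangle: it is distinguished, `L` and `N` are
indecomposable, `N ⟶ L[1]` is nonzero, and every morphism to `N` which is not a split epimorphism
factors through `M ⟶ N`. (When the ends have local endomorphism rings, the dual property of
`L ⟶ M` follows.) -/
structure IsARTriangle (T : Triangle C) : Prop where
  distinguished : T ∈ distTriang C
  indecomposable_left : Indecomposable T.obj₁
  indecomposable_right : Indecomposable T.obj₃
  ne_zero : T.mor₃ ≠ 0
  lift : ∀ (W : C) (t : W ⟶ T.obj₃), ¬ IsSplitEpi t → ∃ s : W ⟶ T.obj₂, s ≫ T.mor₂ = t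

variable (C)

/-- The Auslander-Reiten quiver of a triangulated category: vertices are isomorphism classes of
indecomposable objects, arrows are valued by the bimodules `Irr(X, Y)`, and `τ` sends the right
end of an Auslander-Reiten triangle to its left end. -/
def triangulatedARQuiver : ValuedTranslationQuiver.{u} where
  Vertex := IndecClass C
  valuation x y := irrValuation x.rep y.rep
  IsTranslate x z := ∃ T : Triangle C, IsARTriangle T ∧
    Nonempty (T.obj₁ ≅ x.rep) ∧ Nonempty (T.obj₃ ≅ z.rep)

end Triangles

/-! ### Finitely generated modules over a finite-dimensional algebra -/

section Modules

/-- The category of finitely generated modules over a finite-dimensional algebra `Λ` over a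
field `k`. (The field is recorded so that the category is known to be abelian.) -/
@[nolint unusedArguments]
def FDMod (k : Type w) (Λ : Type u) [Field k] [Ring Λ] [Algebra k Λ] [Module.Finite k Λ] :
    Type (u + 1) :=
  FGModuleCat.{u} Λ

variable (k : Type w) (Λ : Type u) [Field k] [Ring Λ] [Algebra k Λ] [Module.Finite k Λ]

instance : Category.{u} (FDMod k Λ) :=
  inferInstanceAs (Category.{u} (FGModuleCat.{u} Λ))

instance : Abelian (FDMod k Λ) :=
  haveI : IsNoetherianRing Λ := isNoetherian_of_tower k inferInstance
  inferInstanceAs (Abelian (FGModuleCat.{u} Λ))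

end Modules

/-! ### The bounded derived category -/

section Bounded

variable {A : Type u} [Category.{v} A] [Abelian A] [HasDerivedCategory.{w} A]

/-- An object of the bounded derived category is (isomorphic to) a module if it is isomorphic
to a complex concentrated in degree `0`. -/
def IsModule (X : DerivedCategory.Bounded A) : Prop :=
  ∃ M : A, Nonempty (X.obj ≅ (DerivedCategory.singleFunctor A 0).obj M)

variable (A)

/-- The functor `H₀` on the bounded derived category. -/
abbrev H₀ : DerivedCategory.Bounded A ⥤ A :=
  DerivedCategory.Bounded.ι ⋙ DerivedCategory.homologyFunctor A 0

end Bounded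

end AuslanderReiten

end

noncomputable section

namespace AuslanderReiten

/-! ### Local endomorphism rings and the radical -/

section LocalEnd

/-! Placing a module in degree `0` embeds the abelian category fully faithfully in its bounded
derived category, with `H₀` as inverse on the objects that are modules. The long exact homology
sequence shows that these objects are closed under extensions and that a distinguished triangle of
modules becomes a short exact sequence. Non-splitness and the lifting property of an AR triangle
then pass through `H₀`. The extension property of the left map is not part of the definition of an
AR triangle: it follows from locality of the endomorphism ring of the left end
(`IsARTriangle.extend`), which is Fitting's lemma (`FDMod.hasLocalEnd`).

For unions of meshes the issue is that `Irr` might change. The radical is the same in both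
categories by full faithfulness, but a radical composite in the derived category may pass through a
complex that is not a module. If `L ⟶ M ⟶ N` comes from an AR triangle with modules as ends, every
radical map into `N` factors through the radical map `M ⟶ N`, so each such composite ending at `N`
can be rerouted through the module `M`; dually for composites starting at `L`. Hence valuations
agree at every pair `(Y, N)` and `(L, Y)` of modules. Every arrow of a mesh is of this kind, and the
rest is combinatorics of quivers (`Part.IsUnionOfMeshes.exists_iso`). -/

lemma isZero_of_isIso_zero {C : Type u} [Category.{v} C] [HasZeroMorphisms C] {X Y : C} (h : IsIso (0 : X ⟶ Y)) :
    IsZero X ∧ IsZero Y :=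
  ⟨(IsZero.iff_id_eq_zero X).2 (by rw [← IsIso.hom_inv_id (0 : X ⟶ Y), zero_comp]),
    (IsZero.iff_id_eq_zero Y).2 (by rw [← IsIso.inv_hom_id (0 : X ⟶ Y), comp_zero])⟩

variable {C : Type u} [Category.{v} C] [Preadditive C]

/-- For a nonzero object `X`, this says that the endomorphism ring of `X` is local. -/
def HasLocalEnd (X : C) : Prop :=
  ∀ φ : X ⟶ X, IsIso φ ∨ IsIso (𝟙 X - φ)

lemma HasLocalEnd.of_iso {X Y : C} (hX : HasLocalEnd X) (e : X ≅ Y) : HasLocalEnd Y := by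
  intro φ
  have h₁ : φ = e.inv ≫ (e.hom ≫ φ ≫ e.inv) ≫ e.hom := by simp
  have h₂ : 𝟙 Y - φ = e.inv ≫ (𝟙 X - e.hom ≫ φ ≫ e.inv) ≫ e.hom := by simp
  rcases hX (e.hom ≫ φ ≫ e.inv) with h | h
  · left
    rw [h₁]
    infer_instance
  · right
    rw [h₂]
    infer_instance

lemma HasLocalEnd.map {D : Type*} [Category D] [Preadditive D] (F : C ⥤ D) [F.Additive] [F.Full]
    {X : C} (hX : HasLocalEnd X) : HasLocalEnd (F.obj X) := by
  intro φ
  obtain ⟨φ, rfl⟩ := F.map_surjective φ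
  rcases hX φ with h | h
  · exact Or.inl inferInstance
  · right
    rw [← F.map_id, ← F.map_sub]
    infer_instance

lemma InRadical.not_isSplitEpi {X Y : C} {f : X ⟶ Y} (hf : InRadical f) (hY : ¬ IsZero Y) :
    ¬ IsSplitEpi f := by
  rintro ⟨⟨s, hs⟩⟩
  have := hf s
  have h := isIso_one_sub_swap f s
  rw [hs, sub_self] at h
  exact hY (isZero_of_isIso_zero h).1

lemma InRadical.not_isSplitMono {X Y : C} {f : X ⟶ Y} (hf : InRadical f) (hX : ¬ IsZero X) :
    ¬ IsSplitMono f := by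
  rintro ⟨⟨r, hr⟩⟩
  have h := hf r
  rw [hr, sub_self] at h
  exact hX (isZero_of_isIso_zero h).1

/-- Translates the almost split property, phrased by split epimorphisms, into the language of the
radical. If `g ≫ f` were invertible, `f` would split; so locality makes `𝟙 Y - g ≫ f` invertible. -/
lemma HasLocalEnd.inRadical_of_not_isSplitEpi {X Y : C} (hY : HasLocalEnd Y) {f : X ⟶ Y}
    (hf : ¬ IsSplitEpi f) : InRadical f := by
  intro g
  rcases hY (g ≫ f) with h | h
  · exact (hf ⟨⟨inv (g ≫ f) ≫ g, by simp⟩⟩).elim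
  · exact isIso_one_sub_swap g f

lemma HasLocalEnd.inRadical_of_not_isSplitMono {X Y : C} (hX : HasLocalEnd X) {f : X ⟶ Y}
    (hf : ¬ IsSplitMono f) : InRadical f := by
  intro g
  rcases hX (f ≫ g) with h | h
  · exact (hf ⟨⟨g ≫ inv (f ≫ g), by rw [← Category.assoc, IsIso.hom_inv_id]⟩⟩).elim
  · exact h

lemma inRadical_map_iff {D : Type*} [Category D] [Preadditive D] (F : C ⥤ D) [F.Additive]
    [F.Full] [F.Faithful] {X Y : C} (f : X ⟶ Y) : InRadical (F.map f) ↔ InRadical f := by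
  constructor
  · intro h g
    have := h (F.map g)
    rw [← F.map_comp, ← F.map_id, ← F.map_sub] at this
    exact isIso_of_fully_faithful F _
  · intro h g
    obtain ⟨g, rfl⟩ := F.map_surjective g
    have := h g
    rw [← F.map_comp, ← F.map_id, ← F.map_sub]
    infer_instance

end LocalEnd

/-! ### Indecomposable objects and their isomorphism classes -/

section Indecomposables

variable {C : Type u} [Category.{v} C]

lemma indecomposable_of_iso [HasZeroMorphisms C] [HasBinaryBiproducts C] {X Y : C}
    (hX : Indecomposable X) (e : X ≅ Y) : Indecomposable Y :=
  ⟨fun h => hX.1 (h.of_iso e), fun U V i => hX.2 U V (e ≪≫ i)⟩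

/-- The two projections of a decomposition are idempotents with sum `1`. By locality one of them is
invertible; as it kills the other summand, that summand is zero. -/
lemma HasLocalEnd.indecomposable [Preadditive C] [HasBinaryBiproducts C] {X : C}
    (hX : HasLocalEnd X) (hX₀ : ¬ IsZero X) : Indecomposable X := by
  refine ⟨hX₀, fun U V i => ?_⟩
  have h : 𝟙 (U ⊞ V) - biprod.fst ≫ biprod.inl = biprod.snd ≫ biprod.inr := by
    rw [← biprod.total]; abel
  rcases hX.of_iso i (biprod.fst ≫ biprod.inl) with h' | h'
  · right
    have h₀ : (biprod.fst : U ⊞ V ⟶ U) ≫ (biprod.inl : U ⟶ U ⊞ V) ≫ biprod.snd = 0 := by simp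
    rw [← Category.assoc, ← comp_zero, cancel_epi] at h₀
    rw [IsZero.iff_id_eq_zero, ← biprod.inr_snd (X := U), h₀, comp_zero]
  · left
    rw [h] at h'
    have h₀ : (biprod.snd : U ⊞ V ⟶ V) ≫ (biprod.inr : V ⟶ U ⊞ V) ≫ biprod.fst = 0 := by simp
    rw [← Category.assoc, ← comp_zero, cancel_epi] at h₀
    rw [IsZero.iff_id_eq_zero, ← biprod.inl_fst (Y := V), h₀, comp_zero]

lemma indecomposable_of_map {D : Type*} [Category D] [Preadditive C] [HasBinaryBiproducts C]
    [Preadditive D] [HasBinaryBiproducts D] (F : C ⥤ D) [F.Additive] [F.Faithful] {X : C}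
    (hX : Indecomposable (F.obj X)) : Indecomposable X := by
  have : F.PreservesZeroMorphisms := inferInstance
  have key : ∀ U : C, IsZero (F.obj U) → IsZero U := fun U hU => by
    rw [IsZero.iff_id_eq_zero] at hU ⊢
    exact F.map_injective (by rw [F.map_id, hU, F.map_zero])
  refine ⟨fun h => hX.1 (F.map_isZero h), fun U V i => ?_⟩
  have := preservesBinaryBiproducts_of_preservesBiproducts F
  exact (hX.2 _ _ (F.mapIso i ≪≫ F.mapBiprod U V)).imp (key U) (key V)

end Indecomposables

section Rep

variable {C : Type u} [Category.{v} C] [HasZeroMorphisms C] [HasBinaryBiproducts C]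

lemma IndecClass.indecomposable_rep (x : IndecClass C) : Indecomposable x.rep :=
  (Quotient.out (s := indecSetoid C) x).2

lemma IndecClass.rep_mk (X : C) (hX : Indecomposable X) :
    Nonempty ((IndecClass.mk X hX).rep ≅ X) :=
  Quotient.mk_out (s := indecSetoid C) ⟨X, hX⟩

lemma IndecClass.eq_of_iso {x y : IndecClass C} (e : x.rep ≅ y.rep) : x = y := by
  rw [← Quotient.out_eq (s := indecSetoid C) x, ← Quotient.out_eq (s := indecSetoid C) y]
  exact Quotient.sound (s := indecSetoid C) ⟨e⟩

end Rep

/-! ### Almost split properties of AR triangles -/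

section Triangles

variable {C : Type u} [Category.{v} C] [Preadditive C] [HasZeroObject C] [HasShift C ℤ]
  [∀ n : ℤ, (shiftFunctor C n).Additive] [Pretriangulated C] {T : Triangle C}

lemma IsARTriangle.not_isSplitEpi (hT : IsARTriangle T) : ¬ IsSplitEpi T.mor₂ := fun h =>
  hT.ne_zero (by
    rw [← cancel_epi T.mor₂, comp_zero, comp_distTriang_mor_zero₂₃ _ hT.distinguished])

lemma IsARTriangle.not_isSplitMono (hT : IsARTriangle T) : ¬ IsSplitMono T.mor₁ := fun h =>
  hT.ne_zero (by
    rw [← cancel_mono (T.mor₁⟦(1 : ℤ)⟧'), zero_comp,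
      comp_distTriang_mor_zero₃₁ _ hT.distinguished])

/-- The left map of an Auslander-Reiten triangle is left almost split. -/
lemma IsARTriangle.extend (hT : IsARTriangle T) (hL : HasLocalEnd T.obj₁) {W : C}
    (t : T.obj₁ ⟶ W) (ht : ¬ IsSplitMono t) : ∃ s : T.obj₂ ⟶ W, T.mor₁ ≫ s = t := by
  -- The composite `T.mor₃ ≫ t⟦1⟧'` is the obstruction to extending `t` along `T.mor₁`.
  by_cases h₀ : T.mor₃ ≫ t⟦(1 : ℤ)⟧' = 0
  · obtain ⟨s, hs, -⟩ := complete_distinguished_triangle_morphism₂ T _ hT.distinguished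
      (contractible_distinguished W) t 0 (by rw [zero_comp]; exact h₀)
    exact ⟨s, hs.trans (Category.comp_id t)⟩
  -- `E` plays the role of the pushout of `T` along `t`. As the obstruction is nonzero, `p` does not
  -- split and so lifts to `T.obj₂`; the induced `u` satisfies `T.mor₃ ≫ (𝟙 - t ≫ u)⟦1⟧' = 0`, and
  -- locality then contradicts either `ht` or `T.mor₃ ≠ 0`.
  obtain ⟨E, i, p, hE⟩ := distinguished_cocone_triangle₂ (T.mor₃ ≫ t⟦(1 : ℤ)⟧')
  have hp : ¬ IsSplitEpi p := fun _ => h₀ (by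
    rw [← cancel_epi p, comp_zero]
    exact comp_distTriang_mor_zero₂₃ _ hE)
  obtain ⟨s, hs⟩ := hT.lift _ p hp
  obtain ⟨u, hu⟩ : ∃ u : W ⟶ T.obj₁, (T.mor₃ ≫ t⟦(1 : ℤ)⟧') ≫ u⟦(1 : ℤ)⟧' = T.mor₃ := by
    obtain ⟨u, -, hu⟩ := complete_distinguished_triangle_morphism₁ _ _ hE hT.distinguished s
      (𝟙 T.obj₃) (show p ≫ 𝟙 _ = s ≫ T.mor₂ by rw [Category.comp_id, hs])
    exact ⟨u, hu.trans (Category.id_comp _)⟩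
  exfalso
  rcases hL (t ≫ u) with h | h
  · exact ht ⟨⟨u ≫ inv (t ≫ u), by rw [← Category.assoc, IsIso.hom_inv_id]⟩⟩
  · refine hT.ne_zero ?_
    rw [← cancel_mono ((𝟙 T.obj₁ - t ≫ u)⟦(1 : ℤ)⟧'), zero_comp, Functor.map_sub, CategoryTheory.Functor.map_id,
      Preadditive.comp_sub, Category.comp_id, Functor.map_comp, ← Category.assoc, hu, sub_self]

end Triangles

/-! ### Lengths under a change of rings -/

section Length

/-- The length of a quotient is the coheight of the submodule in the submodule lattice, and a
semilinear bijection identifies the lattices. Semilinearity is needed because the two `Irr`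
bimodules live over different, though isomorphic, endomorphism rings. -/
lemma length_quotient_submoduleOf_eq {R S M N : Type*} [Ring R] [Ring S] [AddCommGroup M]
    [AddCommGroup N] [Module R M] [Module S N] (σ : R ≃+* S) (e : M ≃+ N)
    (he : ∀ (r : R) (m : M), e (r • m) = σ r • e m) (P U : Submodule R M) (P' U' : Submodule S N)
    (hP : ∀ m, e m ∈ P' ↔ m ∈ P) (hU : ∀ m, e m ∈ U' ↔ m ∈ U) :
    Module.length R (P ⧸ U.submoduleOf P) = Module.length S (P' ⧸ U'.submoduleOf P') := by
  have := RingHomInvPair.of_ringEquiv σ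
  have := RingHomInvPair.of_ringEquiv_symm σ
  let f : P →ₛₗ[(σ : R →+* S)] P' :=
    { toFun := fun m => ⟨e m, (hP m).2 m.2⟩
      map_add' := fun a b => Subtype.ext (e.map_add a b)
      map_smul' := fun r a => Subtype.ext (he r a) }
  have hf : Function.Bijective f := by
    refine ⟨fun a b h => Subtype.ext (e.injective (congrArg Subtype.val h)), fun b => ?_⟩
    refine ⟨⟨e.symm b, (hP _).1 ?_⟩, Subtype.ext ?_⟩
    · rw [e.apply_symm_apply]
      exact b.2
    · exact e.apply_symm_apply _
  rw [Module.length_quotient, Module.length_quotient,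
    ← Order.coheight_orderIso (Submodule.orderIsoMapComapOfBijective f hf)]
  congr 1
  ext b
  obtain ⟨a, rfl⟩ := hf.2 b
  have h₁ : f a ∈ Submodule.map f (U.submoduleOf P) ↔ a ∈ U.submoduleOf P :=
    ⟨fun ⟨c, hc, h⟩ => hf.1 h ▸ hc, fun h => ⟨a, h, rfl⟩⟩
  exact h₁.trans (hU a.1).symm

lemma apply_mem_span_iff {R S M N : Type*} [Ring R] [Ring S] [AddCommGroup M]
    [AddCommGroup N] [Module R M] [Module S N] (σ : R ≃+* S) (e : M ≃+ N)
    (he : ∀ (r : R) (m : M), e (r • m) = σ r • e m) (A : Set M) (B : Set N)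
    (h : ∀ m, e m ∈ B ↔ m ∈ A) (m : M) :
    e m ∈ Submodule.span S B ↔ m ∈ Submodule.span R A := by
  have := RingHomInvPair.of_ringEquiv σ
  have := RingHomInvPair.of_ringEquiv_symm σ
  let f : M →ₛₗ[(σ : R →+* S)] N := { toFun := e, map_add' := e.map_add, map_smul' := he }
  have hB : B = f '' A := by
    ext b
    obtain ⟨a, rfl⟩ := e.surjective b
    exact (h a).trans ⟨fun ha => ⟨a, ha, rfl⟩, fun ⟨c, hc, hca⟩ => e.injective hca ▸ hc⟩
  rw [hB, ← Submodule.map_span]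
  exact ⟨fun ⟨c, hc, hca⟩ => e.injective hca ▸ hc, fun hm => ⟨m, hm, rfl⟩⟩

end Length

/-! ### Comparing `Irr` along a fully faithful functor -/

section Valuation

variable {C : Type*} [Category C] [Preadditive C] {D : Type*} [Category D] [Preadditive D]
  (F : C ⥤ D) [F.Additive] [F.Full] [F.Faithful]

/-- The bijection on morphisms given by a fully faithful additive functor and isomorphisms in
the target category. -/
def homAddEquiv {X Y : C} {X' Y' : D} (eX : F.obj X ≅ X') (eY : F.obj Y ≅ Y') :
    (X ⟶ Y) ≃+ (X' ⟶ Y') where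
  toFun f := eX.inv ≫ F.map f ≫ eY.hom
  invFun g := F.preimage (eX.hom ≫ g ≫ eY.inv)
  left_inv f := F.map_injective (by simp)
  right_inv g := by simp
  map_add' f g := by simp

/-- The isomorphism of endomorphism rings given by a fully faithful additive functor and an
isomorphism in the target category. -/
def endRingEquiv {X : C} {X' : D} (eX : F.obj X ≅ X') : End X ≃+* End X' :=
  { homAddEquiv F eX eX with
    map_mul' := fun f g => by
      change eX.inv ≫ F.map (g ≫ f) ≫ eX.hom =
        (eX.inv ≫ F.map g ≫ eX.hom) ≫ eX.inv ≫ F.map f ≫ eX.hom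
      simp }

variable {F} {X Y : C} {X' Y' : D} (eX : F.obj X ≅ X') (eY : F.obj Y ≅ Y')

lemma homAddEquiv_apply (f : X ⟶ Y) :
    homAddEquiv F eX eY f = eX.inv ≫ F.map f ≫ eY.hom := rfl

lemma inRadical_iso_comp_iff {X Y Z : C} (e : X ≅ Y) (f : Y ⟶ Z) :
    InRadical (e.hom ≫ f) ↔ InRadical f :=
  ⟨fun h => by simpa using h.precomp e.inv, fun h => h.precomp _⟩

lemma inRadical_comp_iso_iff {X Y Z : C} (f : X ⟶ Y) (e : Y ≅ Z) :
    InRadical (f ≫ e.hom) ↔ InRadical f :=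
  ⟨fun h => by simpa using h.comp e.inv, fun h => h.comp _⟩

lemma inRadical_homAddEquiv_iff (f : X ⟶ Y) :
    InRadical (homAddEquiv F eX eY f) ↔ InRadical f := by
  rw [homAddEquiv_apply, ← inRadical_map_iff F, ← Iso.symm_hom, inRadical_iso_comp_iff,
    inRadical_comp_iso_iff]

lemma homAddEquiv_mem_radicalComposites {f : X ⟶ Y} (hf : f ∈ radicalComposites X Y) :
    homAddEquiv F eX eY f ∈ radicalComposites X' Y' := by
  obtain ⟨Z, a, b, ha, hb, rfl⟩ := hf
  refine ⟨F.obj Z, eX.inv ≫ F.map a, F.map b ≫ eY.hom,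
    ((inRadical_map_iff F a).2 ha).precomp _, ((inRadical_map_iff F b).2 hb).comp _, ?_⟩
  simp [homAddEquiv_apply]

/-- Fullness pulls back both factors once the middle object is in the essential image; this is the
only obstruction to reflecting radical composites. -/
lemma mem_radicalComposites_of_map {f : X ⟶ Y} {Z : C} {M : D} (eM : F.obj Z ≅ M)
    {a : X' ⟶ M} {b : M ⟶ Y'} (ha : InRadical a) (hb : InRadical b)
    (h : a ≫ b = homAddEquiv F eX eY f) : f ∈ radicalComposites X Y := by
  refine ⟨Z, (homAddEquiv F eX eM).symm a, (homAddEquiv F eM eY).symm b, ?_, ?_, ?_⟩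
  · rwa [← inRadical_homAddEquiv_iff eX eM, AddEquiv.apply_symm_apply]
  · rwa [← inRadical_homAddEquiv_iff eM eY, AddEquiv.apply_symm_apply]
  · rw [← AddEquiv.symm_apply_apply (homAddEquiv F eX eY) f, ← h]
    exact F.map_injective (by simp [homAddEquiv])

/-- A fully faithful additive functor preserves the valuation at `(X, Y)` if every composite of
two radical morphisms between the images of `X` and `Y` comes from such a composite in the
source category. -/
lemma irrValuation_eq_of_radicalComposites
    (h : ∀ f : X ⟶ Y, homAddEquiv F eX eY f ∈ radicalComposites X' Y' →
      f ∈ radicalComposites X Y) :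
    irrValuation X' Y' = irrValuation X Y := by
  have h' : ∀ f : X ⟶ Y, homAddEquiv F eX eY f ∈ radicalComposites X' Y' ↔
      f ∈ radicalComposites X Y := fun f => ⟨h f, homAddEquiv_mem_radicalComposites eX eY⟩
  have hs : ∀ (r : (End X)ᵐᵒᵖ) (f : X ⟶ Y), homAddEquiv F eX eY (r • f) =
      (endRingEquiv F eX).op r • homAddEquiv F eX eY f := fun r f => by
    change eX.inv ≫ F.map (r.unop ≫ f) ≫ eY.hom =
      (eX.inv ≫ F.map r.unop ≫ eX.hom) ≫ eX.inv ≫ F.map f ≫ eY.hom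
    simp
  have ht : ∀ (r : End Y) (f : X ⟶ Y), homAddEquiv F eX eY (r • f) =
      endRingEquiv F eY r • homAddEquiv F eX eY f := fun r f => by
    change eX.inv ≫ F.map (f ≫ r) ≫ eY.hom =
      (eX.inv ≫ F.map f ≫ eY.hom) ≫ eY.inv ≫ F.map r ≫ eY.hom
    simp
  exact Prod.ext
    (length_quotient_submoduleOf_eq _ _ hs _ _ _ _ (inRadical_homAddEquiv_iff eX eY)
      (apply_mem_span_iff _ _ hs _ _ h')).symm
    (length_quotient_submoduleOf_eq _ _ ht _ _ _ _ (inRadical_homAddEquiv_iff eX eY)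
      (apply_mem_span_iff _ _ ht _ _ h')).symm

/-- The valuation at `(X, Y)` is preserved if the radical morphisms to the image of `Y` factor
through a radical morphism whose source is in the image of the functor. -/
lemma irrValuation_eq_of_rightAlmostSplit (eX : F.obj X ≅ X') (eY : F.obj Y ≅ Y')
    {Z : C} {M : D} (eM : F.obj Z ≅ M) {p : M ⟶ Y'}
    (hp : InRadical p) (hp' : ∀ (W : D) (t : W ⟶ Y'), InRadical t → ∃ s, s ≫ p = t) :
    irrValuation X' Y' = irrValuation X Y := by
  refine irrValuation_eq_of_radicalComposites eX eY ?_
  rintro f ⟨W, a, b, ha, hb, h⟩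
  -- Rebracketing `a ≫ (s ≫ p)` as `(a ≫ s) ≫ p` replaces the unknown middle object `W` by `M`.
  obtain ⟨s, rfl⟩ := hp' W b hb
  exact mem_radicalComposites_of_map eX eY eM (ha.comp s) hp (by rw [← h, Category.assoc])

/-- The valuation at `(X, Y)` is preserved if the radical morphisms from the image of `X` factor
through a radical morphism whose target is in the image of the functor. -/
lemma irrValuation_eq_of_leftAlmostSplit (eX : F.obj X ≅ X') (eY : F.obj Y ≅ Y')
    {Z : C} {M : D} (eM : F.obj Z ≅ M) {i : X' ⟶ M}
    (hi : InRadical i) (hi' : ∀ (W : D) (t : X' ⟶ W), InRadical t → ∃ s, i ≫ s = t) :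
    irrValuation X' Y' = irrValuation X Y := by
  refine irrValuation_eq_of_radicalComposites eX eY ?_
  rintro f ⟨W, a, b, ha, hb, h⟩
  obtain ⟨s, rfl⟩ := hi' W a ha
  exact mem_radicalComposites_of_map eX eY eM hi (hb.precomp s) (by rw [← h, Category.assoc])

end Valuation

/-! ### Copying unions of meshes -/

namespace ValuedTranslationQuiver

/-- A part of a valued translation quiver which is a union of meshes is copied along an injective
map `ψ` whose image contains its vertices, if translates are reflected by `ψ` and `ψ` preserves the
valuations at all pairs involving an end of a mesh. -/
lemma Part.IsUnionOfMeshes.exists_iso {Q : ValuedTranslationQuiver.{u}}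
    {Q' : ValuedTranslationQuiver.{v}} {ψ : Q'.Vertex → Q.Vertex} (hψ : Function.Injective ψ)
    (htranslate : ∀ a b, Q.IsTranslate (ψ a) (ψ b) → Q'.IsTranslate a b)
    (hright : ∀ a b, Q.IsTranslate (ψ a) (ψ b) →
      ∀ y, Q.valuation (ψ y) (ψ b) = Q'.valuation y b)
    (hleft : ∀ a b, Q.IsTranslate (ψ a) (ψ b) →
      ∀ y, Q.valuation (ψ a) (ψ y) = Q'.valuation a y)
    {Θ : Q.Part} (hΘ : Θ.IsUnionOfMeshes) (hrange : ∀ x ∈ Θ.vertices, x ∈ Set.range ψ) :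
    ∃ Θ' : Q'.Part, Θ'.IsUnionOfMeshes ∧ ∃ φ : Θ.Iso Θ', ∀ x, ψ (φ.toEquiv x).1 = x.1 := by
  obtain ⟨S, hS, hvertices, harrows, htranslates⟩ := hΘ
  have hends : ∀ p ∈ S, ∃ a b, p = (ψ a, ψ b) := fun p hp => by
    obtain ⟨a, ha⟩ := hrange p.1 (by
      rw [hvertices]; exact Set.mem_biUnion hp (Or.inl (Or.inl rfl)))
    obtain ⟨b, hb⟩ := hrange p.2 (by
      rw [hvertices]; exact Set.mem_biUnion hp (Or.inl (Or.inr rfl)))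
    exact ⟨a, b, by rw [ha, hb]⟩
  have hin : ∀ a b, (ψ a, ψ b) ∈ S → ∀ y, Q.Arrow (ψ y) (ψ b) ↔ Q'.Arrow y b :=
    fun a b hab y => by rw [Arrow, Arrow, hright a b (hS _ hab)]
  have hout : ∀ a b, (ψ a, ψ b) ∈ S → ∀ y, Q.Arrow (ψ a) (ψ y) ↔ Q'.Arrow a y :=
    fun a b hab y => by rw [Arrow, Arrow, hleft a b (hS _ hab)]
  -- The copy is the preimage of `Θ` under `ψ`, and it is the union of the meshes indexed by the
  -- preimage of `S`.
  let Θ' : Q'.Part :=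
    { vertices := {a | ψ a ∈ Θ.vertices}
      arrows := {p | (ψ p.1, ψ p.2) ∈ Θ.arrows}
      translates := {p | (ψ p.1, ψ p.2) ∈ Θ.translates} }
  let e : Θ'.vertices ≃ Θ.vertices := Equiv.ofBijective (fun a => ⟨ψ a.1, a.2⟩)
    ⟨fun a b h => Subtype.ext (hψ (congrArg Subtype.val h)), fun ⟨x, hx⟩ => by
      obtain ⟨a, rfl⟩ := hrange x hx
      exact ⟨⟨a, hx⟩, rfl⟩⟩
  have he : ∀ x, ψ (e.symm x).1 = x.1 := fun x => congrArg Subtype.val (e.apply_symm_apply x)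
  refine ⟨Θ', ⟨{p | (ψ p.1, ψ p.2) ∈ S}, fun p hp => htranslate _ _ (hS _ hp), ?_, ?_, ?_⟩,
    ⟨e.symm, fun x y => ?_, fun x y hxy => ?_, fun x y => ?_⟩, he⟩
  · ext y
    simp only [Θ', hvertices, Set.mem_iUnion, Set.mem_ofPred_eq]
    constructor
    · rintro ⟨p, hp, h⟩
      obtain ⟨a, b, rfl⟩ := hends p hp
      refine ⟨(a, b), hp, ?_⟩
      rcases h with (h | h) | h
      · exact Or.inl (Or.inl (hψ h))
      · exact Or.inl (Or.inr (hψ h))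
      · exact Or.inr ((hin a b hp y).1 h)
    · rintro ⟨⟨a, b⟩, hp, h⟩
      refine ⟨(ψ a, ψ b), hp, ?_⟩
      rcases h with (h | h) | h
      · exact Or.inl (Or.inl (congrArg ψ h))
      · exact Or.inl (Or.inr (congrArg ψ h))
      · exact Or.inr ((hin a b hp y).2 h)
  · ext ⟨c, d⟩
    simp only [Θ', harrows, Set.mem_iUnion, Set.mem_ofPred_eq]
    constructor
    · rintro ⟨p, hp, y, hy, hcd, h⟩
      obtain ⟨a, b, rfl⟩ := hends p hp
      refine ⟨(a, b), hp, ?_⟩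
      simp only [Prod.mk.injEq] at h hy hcd
      rcases h with ⟨h₁, rfl⟩ | ⟨rfl, h₂⟩
      · obtain rfl := hψ h₁
        exact ⟨d, (hin _ b hp d).1 hy, (hout _ b hp d).1 hcd, Or.inl rfl⟩
      · obtain rfl := hψ h₂
        exact ⟨c, (hin a _ hp c).1 hy, (hin a _ hp c).1 hcd, Or.inr rfl⟩
    · rintro ⟨⟨a, b⟩, hp, y, hy, hcd, h⟩
      refine ⟨(ψ a, ψ b), hp, ψ y, (hin a b hp y).2 hy, ?_⟩
      rcases h with h | h
      · obtain ⟨rfl, rfl⟩ := Prod.mk.inj h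
        exact ⟨(hout _ b hp _).2 hcd, Or.inl rfl⟩
      · obtain ⟨rfl, rfl⟩ := Prod.mk.inj h
        exact ⟨(hin a _ hp _).2 hcd, Or.inr rfl⟩
  · ext ⟨c, d⟩
    simp only [Θ', htranslates, Set.mem_iUnion, Set.mem_ofPred_eq]
    constructor
    · rintro ⟨p, hp, h⟩
      obtain rfl : (ψ c, ψ d) = p := h
      exact ⟨(c, d), hp, rfl⟩
    · rintro ⟨p, hp, h⟩
      obtain rfl : (c, d) = p := h
      exact ⟨(ψ c, ψ d), hp, rfl⟩
  · change _ ↔ (ψ (e.symm x).1, ψ (e.symm y).1) ∈ Θ.arrows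
    rw [he, he]
  · rw [harrows] at hxy
    simp only [Set.mem_iUnion] at hxy
    obtain ⟨p, hp, z, hz, hxy, h⟩ := hxy
    obtain ⟨a, b, rfl⟩ := hends p hp
    rw [← he x, ← he y] at h ⊢
    -- An arrow of a mesh either starts at its left end or stops at its right end, which are the two
    -- cases where valuations are known to agree.
    rcases h with h | h
    · obtain rfl := hψ (Prod.mk.inj h).1
      exact (hleft _ b (hS _ hp) _).symm
    · obtain rfl := hψ (Prod.mk.inj h).2
      exact (hright a _ (hS _ hp) _).symm
  · change _ ↔ (ψ (e.symm x).1, ψ (e.symm y).1) ∈ Θ.translates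
    rw [he, he]

end ValuedTranslationQuiver

/-! ### Modules inside the bounded derived category -/

section Bounded

variable (A : Type u) [Category.{v} A] [Abelian A] [HasDerivedCategory.{w} A]

/-- The functor sending an object of an abelian category to the complex concentrated in
degree `0`, as an object of the bounded derived category. -/
def boundedSingle : A ⥤ DerivedCategory.Bounded A :=
  ObjectProperty.lift _ (DerivedCategory.singleFunctor A 0)
    (fun _ => ⟨⟨0, inferInstance⟩, ⟨0, inferInstance⟩⟩)

instance : (boundedSingle A).Full :=
  Functor.Full.of_comp_faithful_iso (G := DerivedCategory.Bounded.ι)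
    (Iso.refl (DerivedCategory.singleFunctor A 0))

instance : (boundedSingle A).Faithful :=
  Functor.Faithful.of_comp_iso (G := DerivedCategory.Bounded.ι)
    (Iso.refl (DerivedCategory.singleFunctor A 0))

instance : (boundedSingle A).Additive where
  map_add {X Y f g} := by
    apply DerivedCategory.Bounded.ι.map_injective
    exact (DerivedCategory.singleFunctor A 0).map_add

/-- `H₀` recovers an object from the complex concentrated in degree `0`. -/
def boundedSingleCompH₀Iso : boundedSingle A ⋙ H₀ A ≅ 𝟭 A :=
  DerivedCategory.singleFunctorCompHomologyFunctorIso A 0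

instance : (boundedSingle A ⋙ H₀ A).Full :=
  Functor.Full.of_iso (boundedSingleCompH₀Iso A).symm

instance : (boundedSingle A ⋙ H₀ A).Faithful :=
  Functor.Faithful.of_iso (boundedSingleCompH₀Iso A).symm

variable {A} {X Y : DerivedCategory.Bounded A}

lemma isModule_of_iso {M : A} (e : (boundedSingle A).obj M ≅ X) : IsModule X :=
  ⟨M, ⟨DerivedCategory.Bounded.ι.mapIso e.symm⟩⟩

lemma IsModule.nonempty_iso (hX : IsModule X) :
    ∃ M : A, Nonempty ((boundedSingle A).obj M ≅ X) := by
  obtain ⟨M, ⟨e⟩⟩ := hX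
  exact ⟨M, ⟨DerivedCategory.Bounded.ι.preimageIso
    (X := (boundedSingle A).obj M) (Y := X) e.symm⟩⟩

lemma IsModule.nonempty_iso_H₀ (hX : IsModule X) :
    Nonempty ((boundedSingle A).obj ((H₀ A).obj X) ≅ X) := by
  obtain ⟨M, ⟨e⟩⟩ := hX.nonempty_iso
  exact ⟨(boundedSingle A).mapIso
    ((H₀ A).mapIso e.symm ≪≫ (boundedSingleCompH₀Iso A).app M) ≪≫ e⟩

/-- Conjugating by isomorphisms with degree `0` complexes reduces this to the composite
`boundedSingle A ⋙ H₀ A`, which is isomorphic to the identity. -/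
lemma IsModule.map_H₀_bijective (hX : IsModule X) (hY : IsModule Y) :
    Function.Bijective ((H₀ A).map : (X ⟶ Y) → _) := by
  obtain ⟨M, ⟨e⟩⟩ := hX.nonempty_iso
  obtain ⟨N, ⟨e'⟩⟩ := hY.nonempty_iso
  constructor
  · intro f g h
    rw [← cancel_epi e.hom, ← cancel_mono e'.inv]
    obtain ⟨a, ha⟩ := (boundedSingle A).map_surjective ((e.hom ≫ f) ≫ e'.inv)
    obtain ⟨b, hb⟩ := (boundedSingle A).map_surjective ((e.hom ≫ g) ≫ e'.inv)
    rw [← ha, ← hb]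
    congr 1
    apply (boundedSingle A ⋙ H₀ A).map_injective
    change (H₀ A).map ((boundedSingle A).map a) = (H₀ A).map ((boundedSingle A).map b)
    rw [ha, hb, Functor.map_comp (H₀ A), Functor.map_comp (H₀ A), h, ← Functor.map_comp (H₀ A),
      ← Functor.map_comp (H₀ A)]
  · intro g
    obtain ⟨a, ha⟩ := (boundedSingle A ⋙ H₀ A).map_surjective
      ((H₀ A).map e.hom ≫ g ≫ (H₀ A).map e'.inv)
    refine ⟨e.inv ≫ (boundedSingle A).map a ≫ e'.hom, ?_⟩
    rw [Functor.comp_map] at ha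
    rw [Functor.map_comp (H₀ A), Functor.map_comp (H₀ A), ha]
    simp only [← Functor.map_comp (H₀ A), ← Functor.map_comp_assoc (H₀ A), Category.assoc,
      Iso.inv_hom_id, Category.comp_id, CategoryTheory.Functor.map_id,
      Category.id_comp]

lemma IsModule.isZero_homology (hX : IsModule X) {n : ℤ} (hn : n ≠ 0) :
    IsZero ((DerivedCategory.homologyFunctor A n).obj X.obj) := by
  obtain ⟨M, ⟨e⟩⟩ := hX
  refine IsZero.of_iso ?_ ((DerivedCategory.homologyFunctor A n).mapIso e)
  rcases lt_or_gt_of_ne hn with h | h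
  · exact DerivedCategory.isZero_of_isGE _ 0 n h
  · exact DerivedCategory.isZero_of_isLE _ 0 n h

/-- Modules are closed under extensions in the bounded derived category. -/
lemma isModule_obj₂ {T : Triangle (DerivedCategory.Bounded A)} (hT : T ∈ distTriang _)
    (h₁ : IsModule T.obj₁) (h₃ : IsModule T.obj₃) : IsModule T.obj₂ := by
  have hT' := DerivedCategory.Bounded.ι.map_distinguished T hT
  -- In each nonzero degree the homology of the middle term sits between two zeros in an exact
  -- sequence.
  have key : ∀ n : ℤ, n ≠ 0 → IsZero ((DerivedCategory.homologyFunctor A n).obj T.obj₂.obj) :=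
    fun n hn => (DerivedCategory.HomologySequence.exact₂ _ hT' n).isZero_of_both_zeros
      ((h₁.isZero_homology hn).eq_of_src _ _) ((h₃.isZero_homology hn).eq_of_tgt _ _)
  have : T.obj₂.obj.IsGE 0 := (DerivedCategory.isGE_iff _ _).2 fun i hi => key i hi.ne
  have : T.obj₂.obj.IsLE 0 := (DerivedCategory.isLE_iff _ _).2 fun i hi => key i hi.ne'
  exact DerivedCategory.exists_iso_singleFunctor_obj_of_isGE_of_isLE _ 0

lemma shortExact_map_H₀ {T : Triangle (DerivedCategory.Bounded A)} (hT : T ∈ distTriang _)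
    (h₁ : IsModule T.obj₁) (h₃ : IsModule T.obj₃) :
    ((shortComplexOfDistTriangle T hT).map (H₀ A)).ShortExact := by
  have hT' := DerivedCategory.Bounded.ι.map_distinguished T hT
  exact
    { exact := DerivedCategory.HomologySequence.exact₂ _ hT' 0
      -- Injectivity comes from the vanishing homology of the right end in degree `-1`, surjectivity
      -- from that of the left end in degree `1`.
      mono_f := (DerivedCategory.HomologySequence.mono_homologyMap_mor₁_iff _ hT' (-1) 0
        (by lia)).2 ((h₃.isZero_homology (by lia)).eq_of_src _ _)
      epi_g := (DerivedCategory.HomologySequence.epi_homologyMap_mor₂_iff _ hT' 0 1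
        (by lia)).2 ((h₁.isZero_homology (by lia)).eq_of_tgt _ _) }

lemma IsModule.indecomposable_H₀ (hX : IsModule X) (hX' : Indecomposable X) :
    Indecomposable ((H₀ A).obj X) := by
  obtain ⟨e⟩ := hX.nonempty_iso_H₀
  exact indecomposable_of_map (boundedSingle A) (indecomposable_of_iso hX' e.symm)

lemma IsModule.hasLocalEnd (hA : ∀ M : A, Indecomposable M → HasLocalEnd M) (hX : IsModule X)
    (hX' : Indecomposable X) : HasLocalEnd X := by
  obtain ⟨e⟩ := hX.nonempty_iso_H₀
  exact ((hA _ (hX.indecomposable_H₀ hX')).map (boundedSingle A)).of_iso e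

/-- An Auslander-Reiten triangle of modules gives an Auslander-Reiten sequence. -/
lemma IsARTriangle.isARSequence (hA : ∀ M : A, Indecomposable M → HasLocalEnd M)
    {T : Triangle (DerivedCategory.Bounded A)} (hT : IsARTriangle T) (h₁ : IsModule T.obj₁)
    (h₃ : IsModule T.obj₃) :
    IsARSequence ((shortComplexOfDistTriangle T hT.distinguished).map (H₀ A)) := by
  have h₂ := isModule_obj₂ hT.distinguished h₁ h₃
  refine ⟨shortExact_map_H₀ hT.distinguished h₁ h₃, h₁.indecomposable_H₀ hT.indecomposable_left,
    h₃.indecomposable_H₀ hT.indecomposable_right, ?_, ?_, ?_, ?_⟩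
  · rintro ⟨⟨r, hr⟩⟩
    obtain ⟨r, rfl⟩ := (h₂.map_H₀_bijective h₁).2 r
    refine hT.not_isSplitMono ⟨⟨r, (h₁.map_H₀_bijective h₁).1 ?_⟩⟩
    rw [Functor.map_comp, CategoryTheory.Functor.map_id]
    exact hr
  · rintro ⟨⟨s, hs⟩⟩
    obtain ⟨s, rfl⟩ := (h₃.map_H₀_bijective h₂).2 s
    refine hT.not_isSplitEpi ⟨⟨s, (h₃.map_H₀_bijective h₃).1 ?_⟩⟩
    rw [Functor.map_comp, CategoryTheory.Functor.map_id]
    exact hs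
  · intro W (t : W ⟶ (H₀ A).obj T.obj₃) ht
    -- A test object `W` of `A` is viewed as a degree `0` complex, so that the property of the
    -- triangle applies to it.
    let e : (H₀ A).obj ((boundedSingle A).obj W) ≅ W := (boundedSingleCompH₀Iso A).app W
    obtain ⟨u, hu⟩ := ((isModule_of_iso (Iso.refl ((boundedSingle A).obj W))).map_H₀_bijective
      h₃).2 (e.hom ≫ t)
    obtain ⟨s, rfl⟩ := hT.lift _ u (by
      rintro ⟨⟨s, hs⟩⟩
      refine ht ⟨⟨(H₀ A).map s ≫ e.hom, ?_⟩⟩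
      change ((H₀ A).map s ≫ e.hom) ≫ t = 𝟙 ((H₀ A).obj T.obj₃)
      rw [Category.assoc, ← hu, ← Functor.map_comp (H₀ A), hs, CategoryTheory.Functor.map_id])
    refine ⟨e.inv ≫ (H₀ A).map s, ?_⟩
    change (e.inv ≫ (H₀ A).map s) ≫ (H₀ A).map T.mor₂ = t
    rw [Category.assoc, ← Functor.map_comp (H₀ A), hu, Iso.inv_hom_id_assoc]
  · intro W (t : (H₀ A).obj T.obj₁ ⟶ W) ht
    let e : (H₀ A).obj ((boundedSingle A).obj W) ≅ W := (boundedSingleCompH₀Iso A).app W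
    obtain ⟨u, hu⟩ := (h₁.map_H₀_bijective
      (isModule_of_iso (Iso.refl ((boundedSingle A).obj W)))).2 (t ≫ e.inv)
    obtain ⟨s, rfl⟩ := hT.extend (h₁.hasLocalEnd hA hT.indecomposable_left) u (by
      rintro ⟨⟨r, hr⟩⟩
      refine ht ⟨⟨e.inv ≫ (H₀ A).map r, ?_⟩⟩
      change t ≫ e.inv ≫ (H₀ A).map r = 𝟙 ((H₀ A).obj T.obj₁)
      rw [← Category.assoc, ← hu, ← Functor.map_comp (H₀ A), hr, CategoryTheory.Functor.map_id])
    refine ⟨(H₀ A).map s ≫ e.hom, ?_⟩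
    change (H₀ A).map T.mor₁ ≫ (H₀ A).map s ≫ e.hom = t
    rw [← Category.assoc, ← Functor.map_comp (H₀ A), hu, Category.assoc, Iso.inv_hom_id,
      Category.comp_id]

/-- The vertex of the Auslander-Reiten quiver of the bounded derived category given by an
indecomposable module. -/
def boundedSingleClass (hA : ∀ M : A, Indecomposable M → HasLocalEnd M) (a : IndecClass A) :
    IndecClass (DerivedCategory.Bounded A) :=
  IndecClass.mk ((boundedSingle A).obj a.rep)
    (((hA _ a.indecomposable_rep).map (boundedSingle A)).indecomposable fun h =>
      a.indecomposable_rep.1 (((H₀ A).map_isZero h).of_iso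
        ((boundedSingleCompH₀Iso A).app a.rep).symm))

lemma nonempty_iso_boundedSingleClass_rep (hA : ∀ M : A, Indecomposable M → HasLocalEnd M)
    (a : IndecClass A) : Nonempty ((boundedSingle A).obj a.rep ≅ (boundedSingleClass hA a).rep) :=
  (IndecClass.rep_mk _ _).map Iso.symm

lemma boundedSingleClass_injective (hA : ∀ M : A, Indecomposable M → HasLocalEnd M) :
    Function.Injective (boundedSingleClass hA) := fun a b h => by
  obtain ⟨e⟩ := nonempty_iso_boundedSingleClass_rep hA a
  obtain ⟨e'⟩ := nonempty_iso_boundedSingleClass_rep hA b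
  rw [← h] at e'
  exact IndecClass.eq_of_iso ((boundedSingle A).preimageIso (e ≪≫ e'.symm))

lemma mem_range_boundedSingleClass (hA : ∀ M : A, Indecomposable M → HasLocalEnd M)
    {x : IndecClass (DerivedCategory.Bounded A)} (hx : IsModule x.rep) :
    x ∈ Set.range (boundedSingleClass hA) := by
  obtain ⟨e⟩ := hx.nonempty_iso_H₀
  obtain ⟨i⟩ := IndecClass.rep_mk _ (hx.indecomposable_H₀ x.indecomposable_rep)
  obtain ⟨j⟩ := nonempty_iso_boundedSingleClass_rep hA
    (IndecClass.mk _ (hx.indecomposable_H₀ x.indecomposable_rep))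
  exact ⟨_, IndecClass.eq_of_iso (j.symm ≪≫ (boundedSingle A).mapIso i ≪≫ e)⟩

/-- A union of meshes whose vertices are modules is copied into the Auslander-Reiten quiver of
the abelian category. -/
lemma exists_iso_of_isUnionOfMeshes (hA : ∀ M : A, Indecomposable M → HasLocalEnd M)
    {Θ : (triangulatedARQuiver (DerivedCategory.Bounded A)).Part} (hΘ : Θ.IsUnionOfMeshes)
    (hmod : ∀ x ∈ Θ.vertices, IsModule (IndecClass.rep x)) :
    ∃ Θ' : (abelianARQuiver A).Part, Θ'.IsUnionOfMeshes ∧ ∃ φ : Θ.Iso Θ', ∀ x : Θ.vertices,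
      Nonempty (IndecClass.rep (φ.toEquiv x).1 ≅ (H₀ A).obj (IndecClass.rep x.1)) := by
  have hends : ∀ {T : Triangle (DerivedCategory.Bounded A)} {a b : IndecClass A},
      (T.obj₁ ≅ (boundedSingleClass hA a).rep) → (T.obj₃ ≅ (boundedSingleClass hA b).rep) →
      IsModule T.obj₁ ∧ IsModule T.obj₃ := fun {T a b} i j => by
    obtain ⟨ea⟩ := nonempty_iso_boundedSingleClass_rep hA a
    obtain ⟨eb⟩ := nonempty_iso_boundedSingleClass_rep hA b
    exact ⟨isModule_of_iso (ea ≪≫ i.symm), isModule_of_iso (eb ≪≫ j.symm)⟩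
  -- It is enough that the degree `0` embedding undoes the bijection on vertices; applying `H₀`
  -- recovers the stated isomorphisms.
  suffices h : ∃ Θ' : (abelianARQuiver A).Part, Θ'.IsUnionOfMeshes ∧ ∃ φ : Θ.Iso Θ',
      ∀ x, boundedSingleClass hA (φ.toEquiv x).1 = x.1 by
    obtain ⟨Θ', hΘ', φ, hφ⟩ := h
    refine ⟨Θ', hΘ', φ, fun x => ?_⟩
    obtain ⟨e⟩ := nonempty_iso_boundedSingleClass_rep hA (φ.toEquiv x).1
    rw [hφ x] at e
    exact ⟨((boundedSingleCompH₀Iso A).app _).symm ≪≫ (H₀ A).mapIso e⟩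
  refine hΘ.exists_iso (Q' := abelianARQuiver A) (boundedSingleClass_injective hA) ?_ ?_ ?_
    (fun x hx => mem_range_boundedSingleClass hA (hmod x hx))
  · rintro a b ⟨T, hT, ⟨i⟩, ⟨j⟩⟩
    obtain ⟨ea⟩ := nonempty_iso_boundedSingleClass_rep hA a
    obtain ⟨eb⟩ := nonempty_iso_boundedSingleClass_rep hA b
    obtain ⟨h₁, h₃⟩ := hends i j
    exact ⟨_, hT.isARSequence hA h₁ h₃,
      ⟨(H₀ A).mapIso (i ≪≫ ea.symm) ≪≫ (boundedSingleCompH₀Iso A).app _⟩,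
      ⟨(H₀ A).mapIso (j ≪≫ eb.symm) ≪≫ (boundedSingleCompH₀Iso A).app _⟩⟩
  · rintro a b ⟨T, hT, ⟨i⟩, ⟨j⟩⟩ y
    obtain ⟨eb⟩ := nonempty_iso_boundedSingleClass_rep hA b
    obtain ⟨ey⟩ := nonempty_iso_boundedSingleClass_rep hA y
    obtain ⟨h₁, h₃⟩ := hends i j
    obtain ⟨eM⟩ := (isModule_obj₂ hT.distinguished h₁ h₃).nonempty_iso_H₀
    refine irrValuation_eq_of_rightAlmostSplit ey eb eM (p := T.mor₂ ≫ j.hom) ?_ ?_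
    · exact ((h₃.hasLocalEnd hA hT.indecomposable_right).inRadical_of_not_isSplitEpi
        hT.not_isSplitEpi).comp _
    · intro W t ht
      obtain ⟨s, hs⟩ := hT.lift W (t ≫ j.inv)
        ((ht.comp j.inv).not_isSplitEpi hT.indecomposable_right.1)
      exact ⟨s, by rw [← Category.assoc, hs, Category.assoc, Iso.inv_hom_id, Category.comp_id]⟩
  · rintro a b ⟨T, hT, ⟨i⟩, ⟨j⟩⟩ y
    obtain ⟨ea⟩ := nonempty_iso_boundedSingleClass_rep hA a
    obtain ⟨ey⟩ := nonempty_iso_boundedSingleClass_rep hA y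
    obtain ⟨h₁, h₃⟩ := hends i j
    obtain ⟨eM⟩ := (isModule_obj₂ hT.distinguished h₁ h₃).nonempty_iso_H₀
    have hL := h₁.hasLocalEnd hA hT.indecomposable_left
    refine irrValuation_eq_of_leftAlmostSplit ea ey eM (i := i.inv ≫ T.mor₁) ?_ ?_
    · exact (hL.inRadical_of_not_isSplitMono hT.not_isSplitMono).precomp _
    · intro W t ht
      obtain ⟨s, hs⟩ := hT.extend hL (i.hom ≫ t)
        ((ht.precomp i.hom).not_isSplitMono hT.indecomposable_left.1)
      exact ⟨s, by rw [Category.assoc, hs, Iso.inv_hom_id_assoc]⟩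

end Bounded

/-! ### Fitting's lemma for finitely generated modules -/

section Modules

variable {k : Type w} {Λ : Type u} [Field k] [Ring Λ] [Algebra k Λ] [Module.Finite k Λ]

/-- The underlying module of a finitely generated module. -/
abbrev FDMod.carrier (X : FDMod k Λ) : Type u := FGModuleCat.carrier (R := Λ) X

instance (X : FDMod k Λ) : Module.Finite Λ X.carrier :=
  ObjectProperty.FullSubcategory.property (P := ModuleCat.isFG Λ) X

/-- The underlying linear map of a morphism. -/
def FDMod.toLin {X Y : FDMod k Λ} (f : X ⟶ Y) : X.carrier →ₗ[Λ] Y.carrier :=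
  (InducedCategory.Hom.hom f).hom

/-- The morphism given by a linear map. -/
def FDMod.ofLin {X Y : FDMod k Λ} (f : X.carrier →ₗ[Λ] Y.carrier) : X ⟶ Y :=
  (⟨ModuleCat.ofHom f⟩ : (show FGModuleCat Λ from X) ⟶ (show FGModuleCat Λ from Y))

lemma FDMod.toLin_injective {X Y : FDMod k Λ} :
    Function.Injective (FDMod.toLin : (X ⟶ Y) → (X.carrier →ₗ[Λ] Y.carrier)) :=
  fun _ _ h => FGModuleCat.hom_ext (V := X) (W := Y) h

lemma FDMod.toLin_id (X : FDMod k Λ) : FDMod.toLin (𝟙 X) = 1 := rfl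

lemma FDMod.toLin_sub {X Y : FDMod k Λ} (f g : X ⟶ Y) :
    FDMod.toLin (f - g) = FDMod.toLin f - FDMod.toLin g := rfl

lemma FDMod.isIso_of_isUnit {X : FDMod k Λ} {f : X ⟶ X}
    (h : IsUnit (FDMod.toLin f : Module.End Λ X.carrier)) : IsIso f := by
  obtain ⟨⟨_, g, h₁, h₂⟩, rfl⟩ := h
  exact ⟨FDMod.ofLin g, FDMod.toLin_injective h₂, FDMod.toLin_injective h₁⟩

variable (k) in
/-- A submodule of a finitely generated module, as an object of the category. -/
def FDMod.ofSubmodule {X : FDMod k Λ} (U : Submodule Λ X.carrier) : FDMod k Λ :=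
  haveI : IsNoetherianRing Λ := isNoetherian_of_tower k inferInstance
  FGModuleCat.of Λ U

lemma FDMod.eq_bot_of_isZero {X : FDMod k Λ} {U : Submodule Λ X.carrier}
    (h : IsZero (FDMod.ofSubmodule k U)) : U = ⊥ := by
  rw [Submodule.eq_bot_iff]
  intro x hx
  have h' := congrArg FDMod.toLin ((IsZero.iff_id_eq_zero _).1 h)
  exact congrArg Subtype.val (LinearMap.congr_fun h' (⟨x, hx⟩ : U))

/-- One of the summands in a decomposition of an indecomposable module is trivial. -/
lemma FDMod.eq_bot_or_eq_bot {X : FDMod k Λ} (hX : Indecomposable X)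
    {U V : Submodule Λ X.carrier} (h : IsCompl U V) : U = ⊥ ∨ V = ⊥ := by
  let b : BinaryBicone (FDMod.ofSubmodule k U) (FDMod.ofSubmodule k V) :=
    { pt := X
      fst := FDMod.ofLin (X := X) (Y := FDMod.ofSubmodule k U) (U.projectionOnto V h)
      snd := FDMod.ofLin (X := X) (Y := FDMod.ofSubmodule k V) (V.projectionOnto U h.symm)
      inl := FDMod.ofLin (X := FDMod.ofSubmodule k U) (Y := X) U.subtype
      inr := FDMod.ofLin (X := FDMod.ofSubmodule k V) (Y := X) V.subtype
      inl_fst := FDMod.toLin_injective (LinearMap.ext fun x => Submodule.projectionOnto_apply_left h x)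
      inl_snd := FDMod.toLin_injective (LinearMap.ext fun x => Submodule.projectionOnto_apply_right h.symm x)
      inr_fst := FDMod.toLin_injective (LinearMap.ext fun x => Submodule.projectionOnto_apply_right h x)
      inr_snd := FDMod.toLin_injective (LinearMap.ext fun x => Submodule.projectionOnto_apply_left h.symm x) }
  have hb : b.IsBilimit := isBinaryBilimitOfTotal b (FDMod.toLin_injective
    (Submodule.projection_add_projection_eq_id h))
  exact (hX.2 _ _ (biprod.uniqueUpToIso _ _ hb)).imp FDMod.eq_bot_of_isZero
    FDMod.eq_bot_of_isZero

/-- Fitting's lemma: the endomorphism ring of an indecomposable finitely generated module over a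
finite-dimensional algebra is local. -/
lemma FDMod.hasLocalEnd {X : FDMod k Λ} (hX : Indecomposable X) : HasLocalEnd X := by
  intro φ
  have : IsNoetherianRing Λ := isNoetherian_of_tower k inferInstance
  have : IsArtinianRing Λ := isArtinian_of_tower k inferInstance
  let f : Module.End Λ X.carrier := FDMod.toLin φ
  -- For large `n` the module is the direct sum of the kernel and the range of `f ^ n`, so one of
  -- them vanishes: `f` is then a unit or nilpotent. The condition `n ≠ 0` lets invertibility
  -- descend from `f ^ n` to `f`.
  obtain ⟨n, hn, hn₀⟩ := (f.eventually_isCompl_ker_pow_range_pow.and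
    (Filter.eventually_ne_atTop 0)).exists
  rcases FDMod.eq_bot_or_eq_bot hX hn with h | h
  · left
    refine FDMod.isIso_of_isUnit ((isUnit_pow_iff hn₀).1
      ((Module.End.isUnit_iff (f ^ n)).2 ⟨LinearMap.ker_eq_bot.1 h, LinearMap.range_eq_top.1 ?_⟩))
    rw [h] at hn
    exact eq_top_of_bot_isCompl hn
  · right
    refine FDMod.isIso_of_isUnit ?_
    rw [FDMod.toLin_sub, FDMod.toLin_id]
    exact IsNilpotent.isUnit_one_sub ⟨n, LinearMap.range_eq_bot.1 h⟩

end Modules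

end AuslanderReiten

end

open AuslanderReiten in
theorem mainTheorem11 {k : Type v} {Λ : Type u} [Field k] [Ring Λ] [Algebra k Λ]
    [Module.Finite k Λ] [HasDerivedCategory.{w} (FDMod k Λ)] :
    (∀ (T : Triangle (DerivedCategory.Bounded (FDMod k Λ))) (hT : IsARTriangle T),
      IsModule T.obj₁ → IsModule T.obj₂ → IsModule T.obj₃ →
        IsARSequence
          ((shortComplexOfDistTriangle T hT.distinguished).map (H₀ (FDMod k Λ)))) ∧
    (∀ Θ : (triangulatedARQuiver (DerivedCategory.Bounded (FDMod k Λ))).Part,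
      Θ.IsUnionOfMeshes → (∀ x ∈ Θ.vertices, IsModule (IndecClass.rep x)) →
        ∃ Θ' : (abelianARQuiver (FDMod k Λ)).Part, Θ'.IsUnionOfMeshes ∧
          ∃ φ : Θ.Iso Θ', ∀ x : Θ.vertices,
            Nonempty (IndecClass.rep (φ.toEquiv x).1 ≅
              (H₀ (FDMod k Λ)).obj (IndecClass.rep x.1))) :=
  ⟨fun _ hT h₁ _ h₃ => hT.isARSequence (fun _ => FDMod.hasLocalEnd) h₁ h₃,
    fun _ hΘ hmod => exists_iso_of_isUnionOfMeshes (fun _ => FDMod.hasLocalEnd) hΘ hmod⟩
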